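/- Let $n\ge 2$ be an integer and let $Q_n=\langle a,b \mid a^{2n}=e,\ a^n=b^2,\ ab=ba^{-1}\rangle$ be the dicyclic group of order $4n$. Let $\mathcal{G}(Q_n)$ be its power graph: the simple graph with vertex set $Q_n$ in which distinct $u,v$ are adjacent if and only if one of them is a positive power of the other. For a finite graph $\Gamma$, the Laplacian eigenvalues are the eigenvalues of $L(\Gamma)=D(\Gamma)-A(\Gamma)$ (degree matrix minus adjacency matrix), counted with multiplicity; if $\Gamma$ has at least two vertices, its algebraic connectivity is its second smallest Laplacian eigenvalue; its vertex connectivity is the least number of vertices whose removal leaves a disconnected graph or a graph with exactly one vertex; and $\Gamma$ is Laplacian integral if all its Laplacian eigenvalues are integers. Then the following statements are equivalent: (i) the vertex connectivity and the algebraic connectivity of $\mathcal{G}(Q_n)$ are equal; (ii) the algebraic connectivity of $\mathcal{G}(Q_n)$ is $2$; (iii) the algebraic connectivity of $\mathcal{G}(Q_n)$ is an integer; (iv) $\mathcal{G}(Q_n)$ is Laplacian integral; (v) $Q_n$ is generalized quaternion, that is, $n$ is a power of $2$. -/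

import Mathlib

/-- The power graph of a monoid: the vertices are the elements, and distinct `u`, `v` are adjacent
when one of them is a positive power of the other. -/
def powerGraph (G : Type*) [Monoid G] : SimpleGraph G where
  Adj u v := u ≠ v ∧ ((∃ k : ℕ, 0 < k ∧ v = u ^ k) ∨ (∃ k : ℕ, 0 < k ∧ u = v ^ k))
  symm := ⟨fun _ _ h => ⟨h.1.symm, h.2.symm⟩⟩
  loopless := ⟨fun _ h => h.1 rfl⟩

/-- The vertex connectivity: the least number of vertices whose removal leaves a disconnected
graph or a graph with exactly one vertex. (It is `0` for disconnected graphs and for the graph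
with one vertex, through `S = ∅`.) -/
noncomputable def vertexConnectivity {V : Type*} (Γ : SimpleGraph V) : ℕ :=
  sInf {k : ℕ | ∃ S : Finset V, S.card = k ∧
    (¬ (Γ.induce {v | v ∉ S}).Preconnected ∨ Nat.card {v // v ∉ S} = 1)}

open Classical in
/-- The Laplacian eigenvalues of a finite graph, with multiplicity and in non-increasing order:
the value at `i` is the `(i + 1)`-st largest one. -/
noncomputable def laplacianEigenvalues {V : Type*} [Fintype V] (Γ : SimpleGraph V) :
    Fin (Fintype.card V) → ℝ :=
  (Γ.isHermitian_lapMatrix ℝ).eigenvalues₀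

/-- The algebraic connectivity: the second smallest Laplacian eigenvalue, counted with
multiplicity, of a finite graph with at least two vertices. -/
noncomputable def algebraicConnectivity {V : Type*} [Fintype V] [Nontrivial V]
    (Γ : SimpleGraph V) : ℝ :=
  laplacianEigenvalues Γ
    ⟨Fintype.card V - 2, Nat.sub_lt Fintype.card_pos Nat.two_pos⟩

/-- A finite graph is Laplacian integral if all its Laplacian eigenvalues are integers. -/
def IsLaplacianIntegral {V : Type*} [Fintype V] (Γ : SimpleGraph V) : Prop :=
  ∀ i, ∃ m : ℤ, laplacianEigenvalues Γ i = m

/-- The dicyclic group `Q_n`, for which Mathlib writes `QuaternionGroup n` for every `n`, is called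
generalized quaternion when `n` is a power of `2`. -/
def IsGeneralizedQuaternion (n : ℕ) : Prop :=
  ∃ k : ℕ, n = 2 ^ k

/-! Deleting `1` and `a n` cuts the elements `xa i` off from the rest of `⟨a⟩`, while no single
deletion disconnects the graph, so the vertex connectivity is 2. The algebraic connectivity lies in
`(1, 2]`. It exceeds 1 because `1` is universal and its deletion leaves a connected graph. It is at
most 2 by a test vector that vanishes on the cut and is constant on each side: its Rayleigh quotient
is 1 plus the fraction of its mass on neighbours of `a n`.

If `n` is not a power of 2, some `a j` off the cut is not adjacent to `a n`, so the value lies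
strictly between 1 and 2 and is no integer. If `n` is a power of 2, `⟨a⟩` is a cyclic 2-group, hence
a clique, and `a n` is a second universal vertex. This forces the value 2
(`two_le_algebraicConnectivity`), and every Laplacian eigenvalue is one of 0, 2, 4, `2n`, `4n`. -/

open Finset

/-- The quadratic form of the Laplacian matrix. -/
noncomputable def laplacianForm {V : Type*} [Fintype V] (Γ : SimpleGraph V) (x : V → ℝ) : ℝ :=
  open Classical in (∑ i, ∑ j, if Γ.Adj i j then (x i - x j) ^ 2 else 0) / 2

/-! ### Variational bounds for the algebraic connectivity. -/

section Spectral

variable {V : Type*} [Fintype V] (Γ : SimpleGraph V)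

open Classical in
theorem exists_laplacian_eigenbasis :
    ∃ b : OrthonormalBasis (Fin (Fintype.card V)) ℝ (EuclideanSpace ℝ V),
      (∀ k v, ∑ w, (if Γ.Adj v w then b k v - b k w else 0) =
        laplacianEigenvalues Γ k * b k v) ∧
      ∀ x : EuclideanSpace ℝ V, laplacianForm Γ x =
        ∑ k, laplacianEigenvalues Γ k * inner ℝ (b k) x ^ 2 := by
  have hs := Matrix.isSymmetric_toEuclideanLin_iff.mpr (Γ.isHermitian_lapMatrix ℝ)
  set b := hs.eigenvectorBasis finrank_euclideanSpace with hb
  have key : ∀ k, (Γ.lapMatrix ℝ).toEuclideanLin (b k) = laplacianEigenvalues Γ k • b k :=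
    fun k => hs.apply_eigenvectorBasis finrank_euclideanSpace k
  refine ⟨b, fun k v => ?_, fun x => ?_⟩
  · have h := congrArg (fun y : EuclideanSpace ℝ V => y v) (key k)
    simp only [PiLp.smul_apply, smul_eq_mul] at h
    rw [← h]
    change _ = (Matrix.mulVec (Γ.lapMatrix ℝ) (b k)) v
    rw [Γ.lapMatrix_mulVec_apply, SimpleGraph.degree_eq_sum_if_adj, Finset.sum_mul,
      SimpleGraph.neighborFinset_eq_filter, Finset.sum_filter, ← Finset.sum_sub_distrib]
    refine Finset.sum_congr rfl fun w _ => ?_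
    split_ifs <;> simp
  · have h1 : laplacianForm Γ x = inner ℝ x ((Γ.lapMatrix ℝ).toEuclideanLin x) := by
      have h := Γ.lapMatrix_toLinearMap₂' ℝ x
      rw [Matrix.toLinearMap₂'_apply'] at h
      rw [laplacianForm, ← h, EuclideanSpace.inner_eq_star_dotProduct, dotProduct_comm]
      rfl
    rw [h1, ← b.sum_inner_mul_inner]
    refine Finset.sum_congr rfl fun k _ => ?_
    rw [← hs (b k) x, key k, inner_smul_left, real_inner_comm]
    simp
    ring

theorem laplacianEigenvalues_antitone : Antitone (laplacianEigenvalues Γ) := by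
  classical
  exact Matrix.IsHermitian.eigenvalues₀_antitone _

theorem laplacianForm_smul_one_add_smul (s t : ℝ) (x : V → ℝ) :
    laplacianForm Γ (fun v => s + t * x v) = t ^ 2 * laplacianForm Γ x := by
  classical
  rw [laplacianForm, laplacianForm, mul_div_assoc', Finset.mul_sum]
  congr 1
  refine Finset.sum_congr rfl fun i _ => ?_
  rw [Finset.mul_sum]
  refine Finset.sum_congr rfl fun j _ => ?_
  split_ifs <;> ring

variable [Nontrivial V]

/-- If the conclusion failed, only the last eigenvector `b l` could have eigenvalue below `c`. It
need not be constant, so the form is tested on a combination of `x` and the all-ones vector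
orthogonal to `b l`; adding constants leaves the form unchanged and, as `x` sums to zero, cannot
lower the norm. -/
theorem algebraicConnectivity_lt {c : ℝ} (hc : 0 < c) (x : V → ℝ) (hx0 : ∑ v, x v = 0)
    (hx : laplacianForm Γ x < c * ∑ v, x v ^ 2) : algebraicConnectivity Γ < c := by
  classical
  obtain ⟨b, -, hQ⟩ := exists_laplacian_eigenbasis Γ
  by_contra! hlam
  have hN : 1 < Fintype.card V := Fintype.one_lt_card
  let l : Fin (Fintype.card V) := ⟨Fintype.card V - 1, by omega⟩
  have hge : ∀ k, k ≠ l → c ≤ laplacianEigenvalues Γ k := by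
    intro k hk
    refine hlam.trans (laplacianEigenvalues_antitone Γ ?_)
    have : (k : ℕ) ≠ Fintype.card V - 1 := fun h => hk (Fin.ext h)
    rw [Fin.le_def]
    have := k.2
    change (k : ℕ) ≤ Fintype.card V - 2
    omega
  have hnorm : ∀ y : EuclideanSpace ℝ V, ∑ k, inner ℝ (b k) y ^ 2 = ∑ v, y v ^ 2 := by
    intro y
    rw [← EuclideanSpace.real_norm_sq_eq, ← b.sum_sq_norm_inner_right]
    simp
  have main : ∀ y : EuclideanSpace ℝ V, inner ℝ (b l) y = 0 →
      c * ∑ v, y v ^ 2 ≤ laplacianForm Γ y := by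
    intro y hy
    rw [hQ, ← hnorm, Finset.mul_sum]
    refine Finset.sum_le_sum fun k _ => ?_
    by_cases hk : k = l
    · simp [hk, hy]
    · exact mul_le_mul_of_nonneg_right (hge k hk) (sq_nonneg _)
  set p := ∑ v, b l v with hp
  set q := ∑ v, x v * b l v with hq
  by_cases h : p = 0 ∧ q = 0
  · have := main (WithLp.toLp 2 x) (by simpa [PiLp.inner_apply, hq] using h.2)
    exact absurd hx (not_lt.mpr this)
  · have hx2 : ∑ v, (q + -p * x v) ^ 2 = Fintype.card V * q ^ 2 + p ^ 2 * ∑ v, x v ^ 2 := by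
      have : ∀ v, (q + -p * x v) ^ 2 = q ^ 2 - 2 * p * q * x v + p ^ 2 * x v ^ 2 := by
        intro v; ring
      simp only [this, Finset.sum_add_distrib, Finset.sum_sub_distrib, ← Finset.mul_sum, hx0]
      simp
    have := main (WithLp.toLp 2 fun v => q + -p * x v) (by
      simp only [PiLp.inner_apply, RCLike.inner_apply, conj_trivial, add_mul,
        Finset.sum_add_distrib, mul_assoc, ← Finset.mul_sum, ← hp, ← hq]
      ring)
    change c * ∑ v, (q + -p * x v) ^ 2 ≤ laplacianForm Γ (fun v => q + -p * x v) at this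
    rw [laplacianForm_smul_one_add_smul, hx2] at this
    have hN' : (0 : ℝ) < Fintype.card V := by positivity
    have h2 : p ^ 2 * (c * ∑ v, x v ^ 2 - laplacianForm Γ x) + c * (Fintype.card V * q ^ 2) ≤ 0 := by
      linarith
    have h3 : 0 < c * ∑ v, x v ^ 2 - laplacianForm Γ x := by linarith
    by_cases hp0 : p = 0
    · have hq0 : q ≠ 0 := fun hq0 => h ⟨hp0, hq0⟩
      have : 0 < c * (Fintype.card V * q ^ 2) := by positivity
      rw [hp0] at h2
      linarith
    · have : 0 < p ^ 2 * (c * ∑ v, x v ^ 2 - laplacianForm Γ x) := by positivity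
      have : 0 ≤ c * (Fintype.card V * q ^ 2) := by positivity
      linarith

/-- The plane spanned by the last two eigenvectors meets the hyperplane of zero-sum vectors
nontrivially. -/
theorem exists_laplacianForm_le :
    ∃ x : V → ℝ, x ≠ 0 ∧ ∑ v, x v = 0 ∧
      laplacianForm Γ x ≤ algebraicConnectivity Γ * ∑ v, x v ^ 2 := by
  classical
  obtain ⟨b, -, hQ⟩ := exists_laplacian_eigenbasis Γ
  have hN : 1 < Fintype.card V := Fintype.one_lt_card
  let l : Fin (Fintype.card V) := ⟨Fintype.card V - 1, by omega⟩
  let m : Fin (Fintype.card V) := ⟨Fintype.card V - 2, by omega⟩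
  have hlm : l ≠ m := fun h => by
    have := congrArg Fin.val h
    change Fintype.card V - 1 = Fintype.card V - 2 at this
    omega
  have hle : laplacianEigenvalues Γ l ≤ laplacianEigenvalues Γ m :=
    laplacianEigenvalues_antitone Γ (by rw [Fin.le_def]; change _ - 2 ≤ _ - 1; omega)
  have hnorm : ∀ y : EuclideanSpace ℝ V, ∑ k, inner ℝ (b k) y ^ 2 = ∑ v, y v ^ 2 := by
    intro y
    rw [← EuclideanSpace.real_norm_sq_eq, ← b.sum_sq_norm_inner_right]
    simp
  have main : ∀ s t : ℝ, laplacianForm Γ (WithLp.ofLp (s • b l + t • b m)) ≤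
      algebraicConnectivity Γ * ∑ v, (s • b l + t • b m).ofLp v ^ 2 := by
    intro s t
    rw [hQ, ← hnorm, Finset.mul_sum]
    refine Finset.sum_le_sum fun k _ => ?_
    simp only [inner_add_right, inner_smul_right, OrthonormalBasis.inner_eq_ite]
    by_cases hk : k = l
    · subst hk
      exact mul_le_mul_of_nonneg_right hle (sq_nonneg _)
    · by_cases hk' : k = m
      · subst hk'
        exact le_rfl
      · simp [hk, hk']
  have hne : ∀ s t : ℝ, (s • b l + t • b m : EuclideanSpace ℝ V) = 0 → s = 0 ∧ t = 0 := by
    intro s t h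
    have h1 := congrArg (inner ℝ (b l)) h
    have h2 := congrArg (inner ℝ (b m)) h
    simp [inner_add_right, inner_smul_right, hlm, hlm.symm] at h1 h2
    exact ⟨h1, h2⟩
  obtain ⟨s, t, hst, h0⟩ : ∃ s t : ℝ, ¬ (s = 0 ∧ t = 0) ∧
      s * ∑ v, b l v + t * ∑ v, b m v = 0 := by
    by_cases h : ∑ v, b l v = 0
    · exact ⟨1, 0, by simp, by simp [h]⟩
    · exact ⟨-∑ v, b m v, ∑ v, b l v, by simp [h], by ring⟩
  refine ⟨WithLp.ofLp (s • b l + t • b m), fun h => hst (hne s t ?_), ?_, main s t⟩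
  · ext v
    exact congrFun h v
  · simpa [Finset.sum_add_distrib, ← Finset.mul_sum] using h0

theorem lt_algebraicConnectivity {c : ℝ}
    (h : ∀ x : V → ℝ, x ≠ 0 → ∑ v, x v = 0 → c * ∑ v, x v ^ 2 < laplacianForm Γ x) :
    c < algebraicConnectivity Γ := by
  obtain ⟨x, hx, hx0, hle⟩ := exists_laplacianForm_le Γ
  have hlt := (h x hx hx0).trans_le hle
  exact lt_of_mul_lt_mul_right hlt (Finset.sum_nonneg fun _ _ => sq_nonneg _)

end Spectral

/-! ### Lower bounds from one or two universal vertices. -/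

section Universal

variable {V : Type*} [Fintype V] (Γ : SimpleGraph V)

theorem sum_const_sub_sq {x : V → ℝ} (hx0 : ∑ v, x v = 0) (c : ℝ) :
    ∑ v, (c - x v) ^ 2 = Fintype.card V * c ^ 2 + ∑ v, x v ^ 2 := by
  have : ∀ v, (c - x v) ^ 2 = c ^ 2 - 2 * c * x v + x v ^ 2 := fun v => by ring
  simp only [this, Finset.sum_add_distrib, Finset.sum_sub_distrib, ← Finset.mul_sum, hx0]
  simp

open Classical in
theorem laplacianForm_eq_of_universal {e : V} (he : ∀ v, v ≠ e → Γ.Adj e v)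
    {x : V → ℝ} (hx0 : ∑ v, x v = 0) :
    laplacianForm Γ x = Fintype.card V * x e ^ 2 + ∑ v, x v ^ 2 +
      (∑ i, ∑ j, if Γ.Adj i j ∧ i ≠ e ∧ j ≠ e then (x i - x j) ^ 2 else 0) / 2 := by
  have h : ∀ i j, (if Γ.Adj i j then (x i - x j) ^ 2 else 0) =
      (if i = e then (x e - x j) ^ 2 else 0) + (if j = e then (x e - x i) ^ 2 else 0) +
      if Γ.Adj i j ∧ i ≠ e ∧ j ≠ e then (x i - x j) ^ 2 else 0 := by
    intro i j
    by_cases hi : i = e <;> by_cases hj : j = e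
    · simp [hi, hj]
    · subst hi; simp [hj, he j hj]
    · subst hj; simp [hi, (he i hi).symm]; ring
    · simp [hi, hj]
  simp only [laplacianForm, h, Finset.sum_add_distrib]
  rw [Finset.sum_comm]
  simp [sum_const_sub_sq hx0]
  ring

variable [Nontrivial V]

/-- The edges at `e` alone give Rayleigh quotient at least 1. Equality forces `x e = 0` and makes
`x` constant along the remaining edges, so `x = 0` by connectedness and the zero sum. -/
theorem one_lt_algebraicConnectivity {e : V} (he : ∀ v, v ≠ e → Γ.Adj e v)
    (hconn : (Γ.induce {v | v ∉ ({e} : Finset V)}).Preconnected) :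
    1 < algebraicConnectivity Γ := by
  classical
  refine lt_algebraicConnectivity Γ fun x hx hx0 => ?_
  rw [laplacianForm_eq_of_universal Γ he hx0, one_mul]
  by_contra! hle
  have hterm : ∀ i j, 0 ≤ if Γ.Adj i j ∧ i ≠ e ∧ j ≠ e then (x i - x j) ^ 2 else 0 := by
    intro i j
    split_ifs <;> positivity
  have hR := Finset.sum_nonneg fun i (_ : i ∈ univ) =>
    Finset.sum_nonneg fun j (_ : j ∈ univ) => hterm i j
  have hN : (0 : ℝ) < Fintype.card V := by exact_mod_cast Fintype.card_pos
  have hE : 0 ≤ Fintype.card V * x e ^ 2 := by positivity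
  have hxe : x e = 0 := by
    have : Fintype.card V * x e ^ 2 = 0 := by linarith
    simpa [hN.ne'] using this
  have hR0 := le_antisymm (by linarith) hR
  have hadj : ∀ i j, Γ.Adj i j → i ≠ e → j ≠ e → x i = x j := by
    intro i j h hi hj
    have h1 := (Finset.sum_eq_zero_iff_of_nonneg fun i _ =>
      Finset.sum_nonneg fun j _ => hterm i j).1 hR0 i (Finset.mem_univ i)
    have h2 := (Finset.sum_eq_zero_iff_of_nonneg fun j _ => hterm i j).1 h1 j (Finset.mem_univ j)
    rw [if_pos ⟨h, hi, hj⟩] at h2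
    exact sub_eq_zero.1 (pow_eq_zero_iff two_ne_zero |>.1 h2)
  have hconst : ∀ i j, i ≠ e → j ≠ e → x i = x j := by
    intro i j hi hj
    obtain ⟨p⟩ := hconn ⟨i, by simpa using hi⟩ ⟨j, by simpa using hj⟩
    have : ∀ u v : {v | v ∉ ({e} : Finset V)}, (Γ.induce _).Walk u v → x u = x v := by
      intro u v p
      induction p with
      | nil => rfl
      | @cons u v w h _ ih =>
        exact (hadj _ _ h (by simpa using u.2) (by simpa using v.2)).trans ih
    exact this _ _ p
  obtain ⟨v, hv⟩ := exists_ne e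
  have hsum : ∑ w, x w = (Fintype.card V - 1) * x v := by
    have : ∀ w, x w = x v - if w = e then x v else 0 := by
      intro w
      by_cases hw : w = e
      · simp [hw, hxe]
      · simp [hw, hconst w v hw hv]
    rw [Finset.sum_congr rfl fun w _ => this w]
    simp [Finset.sum_sub_distrib]
    ring
  have hN1 : (1 : ℝ) < Fintype.card V := by exact_mod_cast Fintype.one_lt_card
  have hv0 : x v = 0 := by
    rw [hx0] at hsum
    rcases mul_eq_zero.1 hsum.symm with h | h
    · linarith
    · exact h
  refine hx (funext fun w => ?_)
  by_cases hw : w = e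
  · rw [hw, hxe]; rfl
  · rw [hconst w v hw hv, hv0]; rfl

/-- Each universal vertex contributes `N * x(·) ^ 2 + ∑ x ^ 2`, with `N` the number of vertices. The
shared edge is counted twice, and its surplus `(x z - x e) ^ 2` is absorbed because `N ≥ 2`. -/
theorem two_le_algebraicConnectivity {e z : V} (hez : e ≠ z) (he : ∀ v, v ≠ e → Γ.Adj e v)
    (hz : ∀ v, v ≠ z → Γ.Adj z v) : 2 ≤ algebraicConnectivity Γ := by
  classical
  obtain ⟨x, hx, hx0, hle⟩ := exists_laplacianForm_le Γ
  have hpos : 0 < ∑ v, x v ^ 2 := by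
    obtain ⟨v, hv⟩ := Function.ne_iff.1 hx
    exact Finset.sum_pos' (fun _ _ => sq_nonneg _) ⟨v, Finset.mem_univ v, sq_pos_of_ne_zero hv⟩
  refine le_of_mul_le_mul_right (le_trans ?_ hle) hpos
  rw [laplacianForm_eq_of_universal Γ he hx0]
  -- The negative terms cancel the two ordered copies of the edge `ez`, which the right side
  -- excludes.
  have hterm : ∀ i j, (if i = z then (x z - x j) ^ 2 else 0) +
      (if j = z then (x z - x i) ^ 2 else 0) -
      ((if i = z then if j = e then (x z - x e) ^ 2 else 0 else 0) +
      if j = z then if i = e then (x z - x e) ^ 2 else 0 else 0) ≤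
      if Γ.Adj i j ∧ i ≠ e ∧ j ≠ e then (x i - x j) ^ 2 else 0 := by
    intro i j
    by_cases hi : i = z
    · subst hi
      by_cases hj : j = e
      · subst hj; simp [hez]
      · by_cases hj' : j = i
        · simp [hj', hez.symm]
        · simp [hj, hj', hez.symm, hz j hj']
    · by_cases hj : j = z
      · subst hj
        by_cases hi' : i = e
        · subst hi'; simp [hez]
        · simp [hi, hi', hez.symm, (hz i hi).symm]
          linarith [sub_sq_comm (x j) (x i)]
      · simp only [hi, hj, if_false]
        split_ifs <;> simp; positivity
  have h := Finset.sum_le_sum fun i (_ : i ∈ univ) =>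
    Finset.sum_le_sum fun j (_ : j ∈ univ) => hterm i j
  simp only [Finset.sum_add_distrib, Finset.sum_sub_distrib] at h
  have h1 : (∑ i, ∑ j, if j = z then (x z - x i) ^ 2 else 0) =
    Fintype.card V * x z ^ 2 + ∑ v, x v ^ 2 := by simp [sum_const_sub_sq hx0]
  have h2 : (∑ i, ∑ j, if i = z then (x z - x j) ^ 2 else 0) =
    Fintype.card V * x z ^ 2 + ∑ v, x v ^ 2 := by
    rw [Finset.sum_comm]; exact h1
  have h3 : (∑ i, ∑ j, if i = z then if j = e then (x z - x e) ^ 2 else 0 else 0) =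
    (x z - x e) ^ 2 := by simp
  have h4 : (∑ i, ∑ j, if j = z then if i = e then (x z - x e) ^ 2 else 0 else 0) =
    (x z - x e) ^ 2 := by simp
  rw [h1, h2, h3, h4] at h
  have hN : (2 : ℝ) ≤ Fintype.card V := by exact_mod_cast Fintype.one_lt_card
  nlinarith [sq_nonneg (x z + x e), mul_le_mul_of_nonneg_right hN (sq_nonneg (x z)),
    mul_le_mul_of_nonneg_right hN (sq_nonneg (x e))]

end Universal

/-! ### The form across a two-vertex cut, and eigenvector identities. -/

section Cut

variable {V : Type*} [Fintype V] (Γ : SimpleGraph V)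

open Classical in
theorem laplacianForm_eq_of_cut {e z : V} (hez : e ≠ z) {x : V → ℝ} (hxe : x e = 0) (hxz : x z = 0)
    (hcut : ∀ u v, u ≠ e → u ≠ z → v ≠ e → v ≠ z → Γ.Adj u v → x u = x v) :
    laplacianForm Γ x = (∑ v, if Γ.Adj e v then x v ^ 2 else 0) +
      ∑ v, if Γ.Adj z v then x v ^ 2 else 0 := by
  have h : ∀ i j, (if Γ.Adj i j then (x i - x j) ^ 2 else 0) =
      ((if i = e then if Γ.Adj e j then x j ^ 2 else 0 else 0) +
        (if i = z then if Γ.Adj z j then x j ^ 2 else 0 else 0)) +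
      ((if j = e then if Γ.Adj e i then x i ^ 2 else 0 else 0) +
        (if j = z then if Γ.Adj z i then x i ^ 2 else 0 else 0)) := by
    intro i j
    by_cases hi : i = e
    · subst hi
      by_cases hj : j = i
      · subst hj; simp [hez]
      · by_cases hj' : j = z
        · subst hj'; simp [hez, hez.symm, hxe, hxz]
        · simp [hez, hj, hj', hxe]
    by_cases hi' : i = z
    · subst hi'
      by_cases hj : j = e
      · subst hj; simp [hez, hez.symm, hxe, hxz]
      · by_cases hj' : j = i
        · subst hj'; simp [hez.symm]
        · simp [hez.symm, hj, hj', hxz]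
    by_cases hj : j = e
    · subst hj; simp [hi, hi', hez, hxe, Γ.adj_comm]
    by_cases hj' : j = z
    · subst hj'; simp [hi, hi', hez.symm, hxz, Γ.adj_comm]
    simp only [hi, hi', hj, hj', if_false, add_zero, ite_eq_right_iff]
    intro hadj
    simp [hcut i j hi hi' hj hj' hadj]
  have h2 : ∀ y : V → ℝ, ∀ s, (∑ i : V, ∑ j, if i = s then y j else 0) = ∑ j, y j := by
    intro y s
    rw [Finset.sum_comm]; simp
  have h3 : ∀ y : V → ℝ, ∀ s, (∑ i, ∑ j : V, if j = s then y i else 0) = ∑ j, y j := by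
    intro y s
    simp
  simp only [laplacianForm, h, Finset.sum_add_distrib]
  rw [h2 (fun j => if Γ.Adj e j then x j ^ 2 else 0), h2 (fun j => if Γ.Adj z j then x j ^ 2 else 0),
    h3 (fun j => if Γ.Adj e j then x j ^ 2 else 0), h3 (fun j => if Γ.Adj z j then x j ^ 2 else 0)]
  ring

-- The Laplacian has zero column sums, so eigenvectors for nonzero eigenvalues sum to zero.
open Classical in
theorem mul_sum_eq_zero_of_eigenvector {y : V → ℝ} {μ : ℝ}
    (h : ∀ v, ∑ w, (if Γ.Adj v w then y v - y w else 0) = μ * y v) : μ * ∑ v, y v = 0 := by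
  rw [Finset.mul_sum, ← Finset.sum_congr rfl fun v _ => h v]
  have h1 : (∑ v, ∑ w, if Γ.Adj v w then y v - y w else 0) =
      -∑ v, ∑ w, if Γ.Adj v w then y v - y w else 0 := by
    conv_lhs => rw [Finset.sum_comm]
    simp only [← Finset.sum_neg_distrib]
    refine Finset.sum_congr rfl fun v _ => Finset.sum_congr rfl fun w _ => ?_
    simp only [Γ.adj_comm w v]
    split_ifs <;> ring
  linarith

open Classical in
theorem sum_eq_of_universal {e : V} (he : ∀ v, v ≠ e → Γ.Adj e v) (y : V → ℝ) :
    ∑ w, (if Γ.Adj e w then y e - y w else 0) = Fintype.card V * y e - ∑ w, y w := by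
  have : ∀ w, (if Γ.Adj e w then y e - y w else 0) = y e - y w := by
    intro w
    by_cases hw : w = e
    · simp [hw]
    · simp [he w hw]
  simp [this, Finset.sum_sub_distrib]

end Cut

/-! ### Powers and adjacency in the dicyclic group. -/

namespace QuaternionGroup

variable {n : ℕ}

theorem a_pow (i : ZMod (2 * n)) (k : ℕ) : a i ^ k = a ((k : ZMod (2 * n)) * i) := by
  induction k with
  | zero => simp
  | succ k ih => rw [pow_succ, ih, a_mul_a]; congr 1; push_cast; ring

theorem natCast_add_self : (n + n : ZMod (2 * n)) = 0 := by
  rw [← two_mul]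
  exact_mod_cast ZMod.natCast_self (2 * n)

theorem xa_pow_three (i : ZMod (2 * n)) : xa i ^ 3 = xa (i + (n : ZMod (2 * n))) := by
  rw [pow_succ, xa_sq, a_mul_xa]
  congr 1
  linear_combination -natCast_add_self (n := n)

theorem xa_pow (i : ZMod (2 * n)) (k : ℕ) :
    xa i ^ k = 1 ∨ xa i ^ k = xa i ∨ xa i ^ k = a n ∨ xa i ^ k = xa (i + (n : ZMod (2 * n))) := by
  rw [← Nat.div_add_mod k 4, pow_add, pow_mul, xa_pow_four, one_pow, one_mul]
  have : k % 4 < 4 := Nat.mod_lt _ (by norm_num)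
  interval_cases k % 4
  · simp
  · simp
  · simp
  · simp [xa_pow_three]

theorem natCast_ne_zero [NeZero n] : (n : ZMod (2 * n)) ≠ 0 := by
  rw [Ne, ZMod.natCast_eq_zero_iff]
  intro h
  have := Nat.le_of_dvd (NeZero.pos n) h
  have := NeZero.pos n
  omega

theorem a_natCast_ne_one [NeZero n] : (1 : QuaternionGroup n) ≠ a n := by
  rw [one_def]
  exact fun h => natCast_ne_zero (a.inj h).symm

theorem sum_eq [NeZero n] (f : QuaternionGroup n → ℝ) :
    ∑ g, f g = ∑ i, f (a i) + ∑ i, f (xa i) := by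
  let e : ZMod (2 * n) ⊕ ZMod (2 * n) ≃ QuaternionGroup n :=
    { toFun := Sum.elim a xa
      invFun := fun | a j => Sum.inl j | xa j => Sum.inr j
      left_inv := by rintro (x | x) <;> rfl
      right_inv := by rintro (x | x) <;> rfl }
  rw [← e.sum_comp, Fintype.sum_sum_type]
  rfl

theorem powerGraph_adj_one [NeZero n] (v : QuaternionGroup n) (hv : v ≠ 1) :
    (powerGraph (QuaternionGroup n)).Adj 1 v :=
  ⟨hv.symm, Or.inr ⟨orderOf v, orderOf_pos v, (pow_orderOf_eq_one v).symm⟩⟩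

/-- The powers of `xa i` form a cyclic group of order 4, and `xa i` is a power of no `a j`. -/
theorem powerGraph_adj_xa_iff [NeZero n] (i : ZMod (2 * n)) (w : QuaternionGroup n) :
    (powerGraph (QuaternionGroup n)).Adj (xa i) w ↔ w = 1 ∨ w = a n ∨ w = xa (i + (n : ZMod (2 * n))) := by
  constructor
  · rintro ⟨hne, ⟨k, -, rfl⟩ | ⟨k, -, h⟩⟩
    · rcases xa_pow i k with h | h | h | h
      · exact Or.inl h
      · exact absurd h.symm hne
      · exact Or.inr (Or.inl h)
      · exact Or.inr (Or.inr h)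
    · cases w with
      | a j => rw [a_pow] at h; cases h
      | xa j =>
        rcases xa_pow j k with h' | h' | h' | h' <;> rw [← h] at h'
        · cases h'
        · exact absurd h' hne
        · cases h'
        · refine Or.inr (Or.inr ?_)
          rw [xa.inj h', add_assoc, natCast_add_self, add_zero]
  · rintro (rfl | rfl | rfl)
    · exact (powerGraph_adj_one _ (by rw [one_def]; simp [-a_zero])).symm
    · exact ⟨by simp, Or.inl ⟨2, by norm_num, (xa_sq i).symm⟩⟩
    · refine ⟨fun h => natCast_ne_zero (n := n) ?_, Or.inl ⟨3, by norm_num, (xa_pow_three i).symm⟩⟩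
      simpa using xa.inj h

theorem powerGraph_adj_a_one [NeZero n] (j : ZMod (2 * n)) (hj : j ≠ 1) :
    (powerGraph (QuaternionGroup n)).Adj (a 1) (a j) := by
  -- Adding `2 * n` keeps the exponent positive when `j = 0`.
  refine ⟨fun h => hj (a.inj h).symm, Or.inl ⟨j.val + 2 * n, ?_, ?_⟩⟩
  · have := NeZero.pos n
    omega
  · have h : ((2 * n : ℕ) : ZMod (2 * n)) = 0 := ZMod.natCast_self _
    rw [a_one_pow, Nat.cast_add, h]
    simp

theorem one_ne_natCast (hn : 2 ≤ n) : (1 : ZMod (2 * n)) ≠ n := by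
  intro h
  have h' : ((1 : ℕ) : ZMod (2 * n)) = (n : ℕ) := by simpa using h
  rw [ZMod.natCast_eq_natCast_iff', Nat.mod_eq_of_lt (by omega), Nat.mod_eq_of_lt (by omega)] at h'
  omega

theorem preconnected_compl_one [NeZero n] (hn : 2 ≤ n) :
    ((powerGraph (QuaternionGroup n)).induce
      {v | v ∉ ({1} : Finset (QuaternionGroup n))}).Preconnected := by
  have hz : a (n : ZMod (2 * n)) ∈ {v | v ∉ ({1} : Finset (QuaternionGroup n))} := by
    simpa using a_natCast_ne_one.symm
  have h1 : a (1 : ZMod (2 * n)) ∈ {v | v ∉ ({1} : Finset (QuaternionGroup n))} := by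
    have : Fact (1 < 2 * n) := ⟨by omega⟩
    rw [one_def]
    simp [-a_zero]
  have key : ∀ v, ((powerGraph (QuaternionGroup n)).induce
      {v | v ∉ ({1} : Finset (QuaternionGroup n))}).Reachable v ⟨_, hz⟩ := by
    have hz1 : ((powerGraph (QuaternionGroup n)).induce
      {v | v ∉ ({1} : Finset (QuaternionGroup n))}).Reachable ⟨_, h1⟩ ⟨_, hz⟩ :=
      SimpleGraph.Adj.reachable (powerGraph_adj_a_one (n : ZMod (2 * n)) (one_ne_natCast hn).symm)
    rintro ⟨v, hv⟩
    cases v with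
    | a j =>
      by_cases hj : j = 1
      · subst hj; exact hz1
      · refine (SimpleGraph.Reachable.symm ?_).trans hz1
        exact SimpleGraph.Adj.reachable (powerGraph_adj_a_one j hj)
    | xa j => exact SimpleGraph.Adj.reachable ((powerGraph_adj_xa_iff j _).2 (Or.inr (Or.inl rfl)))
  exact fun u v => (key u).trans (key v).symm

theorem vertexConnectivity_powerGraph [NeZero n] (hn : 2 ≤ n) :
    vertexConnectivity (powerGraph (QuaternionGroup n)) = 2 := by
  have hmem : 2 ∈ {k : ℕ | ∃ S : Finset (QuaternionGroup n), S.card = k ∧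
      (¬ ((powerGraph (QuaternionGroup n)).induce {v | v ∉ S}).Preconnected ∨
        Nat.card {v // v ∉ S} = 1)} := by
    refine ⟨{1, a n}, Finset.card_pair a_natCast_ne_one, Or.inl fun h => ?_⟩
    have h0 : (xa 0 : QuaternionGroup n) ∉ ({1, a n} : Finset (QuaternionGroup n)) := by
      rw [one_def]; simp [-a_zero]
    have h1 : (a 1 : QuaternionGroup n) ∉ ({1, a n} : Finset (QuaternionGroup n)) := by
      have : Fact (1 < 2 * n) := ⟨by omega⟩
      rw [one_def]; simp [-a_zero, one_ne_natCast hn]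
    obtain ⟨p⟩ := h ⟨xa 0, h0⟩ ⟨a 1, h1⟩
    -- A walk avoiding `1` and `a n` can only alternate between `xa i` and `xa (i + n)`.
    have inv : ∀ u v : {v | v ∉ ({1, a n} : Finset (QuaternionGroup n))},
        ((powerGraph (QuaternionGroup n)).induce _).Walk u v →
        (∃ i, u.1 = xa i) → ∃ i, v.1 = xa i := by
      intro u v p
      induction p with
      | nil => exact id
      | @cons u v w h _ ih =>
        rintro ⟨i, hi⟩
        refine ih ⟨i + n, ?_⟩
        have h' : (powerGraph (QuaternionGroup n)).Adj u.1 v.1 := h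
        rw [hi, powerGraph_adj_xa_iff] at h'
        have hv := v.2
        simp only [Set.mem_ofPred_eq, Finset.mem_insert, Finset.mem_singleton, not_or] at hv
        simpa [hv.1, hv.2] using h'
    obtain ⟨i, hi⟩ := inv _ _ p ⟨0, rfl⟩
    cases hi
  refine le_antisymm (Nat.sInf_le hmem) (le_csInf ⟨2, hmem⟩ ?_)
  rintro k ⟨S, rfl, hS⟩
  by_contra! hlt
  rcases hS with hS | hS
  · apply hS
    by_cases h1 : 1 ∈ S
    · rw [Finset.eq_of_subset_of_card_le (Finset.singleton_subset_iff.2 h1)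
        (by rw [Finset.card_singleton]; omega) |>.symm]
      exact preconnected_compl_one hn
    · have key : ∀ v, ((powerGraph (QuaternionGroup n)).induce {v | v ∉ S}).Reachable ⟨1, h1⟩ v := by
        rintro ⟨v, hv⟩
        by_cases hv1 : v = 1
        · subst hv1; exact SimpleGraph.Reachable.refl _
        · exact SimpleGraph.Adj.reachable (powerGraph_adj_one v hv1)
      exact fun u v => (key u).symm.trans (key v)
  · have h2 : Nat.card {v // v ∉ S} = 4 * n - S.card := by
      rw [Nat.card_eq_fintype_card, Fintype.card_subtype_compl, QuaternionGroup.card]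
      simp
    omega

/-! ### Bounds for the algebraic connectivity of the power graph. -/

open Classical in
theorem exists_test_vector [NeZero n] (hn : 2 ≤ n) : ∃ x : QuaternionGroup n → ℝ,
    ∑ v, x v = 0 ∧ 0 < ∑ v, x v ^ 2 ∧ (∀ j : ZMod (2 * n), j ≠ 0 → j ≠ n → x (a j) ≠ 0) ∧
    laplacianForm (powerGraph (QuaternionGroup n)) x = ∑ v, x v ^ 2 +
      ∑ v, if (powerGraph (QuaternionGroup n)).Adj (a n) v then x v ^ 2 else 0 := by
  have hn' : (2 : ℝ) ≤ n := by exact_mod_cast hn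
  -- The values are 0 on the cut, `-n` on the other `2n - 2` elements of `⟨a⟩` and `n - 1` on the
  -- `2n` elements `xa i`, so the sum is zero.
  let x : QuaternionGroup n → ℝ := fun
    | a i => -n + (if i = 0 then (n : ℝ) else 0) + if i = n then (n : ℝ) else 0
    | xa _ => n - 1
  have hxe : x 1 = 0 := by
    change -n + (if (0 : ZMod (2 * n)) = 0 then (n : ℝ) else 0) +
      (if (0 : ZMod (2 * n)) = n then (n : ℝ) else 0) = 0
    simp [natCast_ne_zero.symm]
  have hxz : x (a n) = 0 := by simp [x, natCast_ne_zero]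
  have hxa : ∀ j : ZMod (2 * n), j ≠ 0 → j ≠ n → x (a j) = -n := by
    intro j h0 h1
    simp [x, h0, h1]
  refine ⟨x, ?_, ?_, ?_, ?_⟩
  · rw [sum_eq]
    simp [x, Finset.sum_add_distrib, ZMod.card]
    ring
  · refine Finset.sum_pos' (fun _ _ => sq_nonneg _) ⟨xa 0, Finset.mem_univ _, ?_⟩
    have : (0 : ℝ) < n - 1 := by linarith
    exact pow_pos this 2
  · intro j h0 h1
    rw [hxa j h0 h1]
    have : (n : ℝ) ≠ 0 := by positivity
    simpa
  · rw [laplacianForm_eq_of_cut _ a_natCast_ne_one hxe hxz]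
    · congr 1
      refine Finset.sum_congr rfl fun v _ => ?_
      by_cases hv : v = 1
      · simp [hv, hxe]
      · rw [if_pos (powerGraph_adj_one v hv)]
    · intro u v hu hu' hv hv' h
      cases u with
      | xa i =>
        rw [powerGraph_adj_xa_iff] at h
        simp only [hv, hv', false_or] at h
        rw [h]
      | a i =>
        cases v with
        | xa j =>
          have h' := (powerGraph_adj_xa_iff j _).1 h.symm
          simp [hu, hu'] at h'
        | a j =>
          rw [one_def] at hu hv
          rw [hxa i (fun h => hu (by rw [h])) (fun h => hu' (by rw [h])),
            hxa j (fun h => hv (by rw [h])) (fun h => hv' (by rw [h]))]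

theorem one_lt_algebraicConnectivity_powerGraph [NeZero n] (hn : 2 ≤ n) :
    1 < algebraicConnectivity (powerGraph (QuaternionGroup n)) :=
  one_lt_algebraicConnectivity _ powerGraph_adj_one (preconnected_compl_one hn)

theorem algebraicConnectivity_powerGraph_le_two [NeZero n] (hn : 2 ≤ n) :
    algebraicConnectivity (powerGraph (QuaternionGroup n)) ≤ 2 := by
  classical
  obtain ⟨x, hx0, hpos, -, hx⟩ := exists_test_vector hn
  refine le_of_forall_gt fun c hc => algebraicConnectivity_lt _ (by linarith) x hx0 ?_
  have : (∑ v, if (powerGraph (QuaternionGroup n)).Adj (a n) v then x v ^ 2 else 0) ≤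
      ∑ v, x v ^ 2 := by
    refine Finset.sum_le_sum fun v _ => ?_
    split_ifs
    · rfl
    · positivity
  rw [hx]
  nlinarith

theorem algebraicConnectivity_powerGraph_lt_two [NeZero n] (hn : 2 ≤ n)
    {j : ZMod (2 * n)} (h0 : j ≠ 0) (h1 : j ≠ n)
    (hj : ¬ (powerGraph (QuaternionGroup n)).Adj (a n) (a j)) :
    algebraicConnectivity (powerGraph (QuaternionGroup n)) < 2 := by
  classical
  obtain ⟨x, hx0, hpos, hne, hx⟩ := exists_test_vector hn
  refine algebraicConnectivity_lt _ two_pos x hx0 ?_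
  have : (∑ v, if (powerGraph (QuaternionGroup n)).Adj (a n) v then x v ^ 2 else 0) <
      ∑ v, x v ^ 2 := by
    refine Finset.sum_lt_sum (fun v _ => ?_) ⟨a j, Finset.mem_univ _, ?_⟩
    · split_ifs
      · rfl
      · positivity
    · rw [if_neg hj]
      exact sq_pos_of_ne_zero (hne j h0 h1)
  rw [hx]
  linarith

/-- With `m` the 2-part of `n`, the witness is `j = 2 * m`. Powers of `a n` are only `1` and `a n`.
Conversely, multiples of `2 * m` modulo `2 * n` stay divisible by `2 * m`, which does not divide
`n`. -/
theorem exists_not_adj_of_not_two_pow [NeZero n] (h : ¬ IsGeneralizedQuaternion n) :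
    ∃ j : ZMod (2 * n), j ≠ 0 ∧ j ≠ n ∧
      ¬ (powerGraph (QuaternionGroup n)).Adj (a n) (a j) := by
  obtain ⟨k, p, hp, hnp⟩ := Nat.exists_eq_two_pow_mul_odd (NeZero.ne n)
  have hp1 : p ≠ 1 := by
    rintro rfl
    exact h ⟨k, by simpa using hnp⟩
  have hn0 := NeZero.pos n
  have hp3 : 3 ≤ p := by
    obtain ⟨q, rfl⟩ := hp
    omega
  have hm : 0 < 2 ^ k := by positivity
  set m := 2 ^ k with hmdef
  have hodd : ∀ c : ℕ, (n : ZMod (2 * n)) ≠ c * ((2 * m : ℕ) : ZMod (2 * n)) := by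
    intro c hc
    have hc' : (n : ZMod (2 * n)) = ((c * (2 * m) : ℕ) : ZMod (2 * n)) := by
      rw [hc]; push_cast; ring
    rw [ZMod.natCast_eq_natCast_iff] at hc'
    have h1 : 2 * m ∣ 2 * n := ⟨p, by rw [hnp]; ring⟩
    have h2 : 2 * m ∣ n := by
      rw [← Nat.modEq_zero_iff_dvd]
      exact (hc'.of_dvd h1).trans (Nat.modEq_zero_iff_dvd.2 ⟨c, by ring⟩)
    rw [hnp, mul_comm 2 m] at h2
    exact (Nat.not_even_iff_odd.2 hp) (even_iff_two_dvd.2 (Nat.dvd_of_mul_dvd_mul_left hm h2))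
  have hj0 : ((2 * m : ℕ) : ZMod (2 * n)) ≠ 0 := by
    rw [Ne, ZMod.natCast_eq_zero_iff]
    intro hd
    have := Nat.le_of_dvd (by omega) hd
    nlinarith
  have hjn : ((2 * m : ℕ) : ZMod (2 * n)) ≠ n := fun h => hodd 1 (by rw [h]; simp)
  refine ⟨((2 * m : ℕ) : ZMod (2 * n)), hj0, hjn, ?_⟩
  rintro ⟨-, ⟨c, -, hc⟩ | ⟨c, -, hc⟩⟩
  · rw [a_pow] at hc
    have hc := a.inj hc
    rcases Nat.even_or_odd' c with ⟨d, rfl | rfl⟩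
    · apply hj0
      rw [hc]
      push_cast
      linear_combination (d : ZMod (2 * n)) * natCast_add_self (n := n)
    · apply hjn
      rw [hc]
      push_cast
      linear_combination (d : ZMod (2 * n)) * natCast_add_self (n := n)
  · rw [a_pow] at hc
    exact hodd c (a.inj hc)

/-- In a cyclic 2-group the subgroups form a chain: the element of smaller 2-adic valuation
generates the other. -/
theorem powerGraph_adj_a_a {k : ℕ} [NeZero (2 ^ k)] {i j : ZMod (2 * 2 ^ k)} (hij : i ≠ j) :
    (powerGraph (QuaternionGroup (2 ^ k))).Adj (a i) (a j) := by
  have key : ∀ i j : ZMod (2 * 2 ^ k), i ≠ 0 → j ≠ 0 →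
      i.val.factorization 2 ≤ j.val.factorization 2 → ∃ c : ℕ, 0 < c ∧ j = c * i := by
    intro i j hi hj hle
    obtain ⟨s, p, hp, hip⟩ := Nat.exists_eq_two_pow_mul_odd
      (show i.val ≠ 0 by rwa [Ne, ZMod.val_eq_zero])
    obtain ⟨t, q, hq, hjq⟩ := Nat.exists_eq_two_pow_mul_odd
      (show j.val ≠ 0 by rwa [Ne, ZMod.val_eq_zero])
    have hfac : ∀ s p : ℕ, Odd p → (2 ^ s * p).factorization 2 = s := by
      intro s p hp
      rw [Nat.factorization_mul (by positivity) hp.pos.ne']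
      simp [Nat.prime_two.factorization_pow,
        Nat.factorization_eq_zero_of_not_dvd fun h => (Nat.not_even_iff_odd.2 hp)
          (even_iff_two_dvd.2 h)]
    rw [hip, hjq, hfac s p hp, hfac t q hq] at hle
    have hcop : p.Coprime (2 * 2 ^ k) := by
      rw [← pow_succ']
      exact (Nat.coprime_two_right.2 hp).pow_right _
    have hunit := ZMod.coe_mul_inv_eq_one p hcop
    -- The odd part `p` of `i` is inverted modulo the group order; the last summand only makes the
    -- exponent positive.
    refine ⟨2 ^ (t - s) * q * (p : ZMod (2 * 2 ^ k))⁻¹.val + 2 * 2 ^ k, by positivity, ?_⟩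
    have hz : ((2 * 2 ^ k : ℕ) : ZMod (2 * 2 ^ k)) = 0 := ZMod.natCast_self _
    have hi' : i = 2 ^ s * p := by
      rw [← ZMod.natCast_zmod_val i, hip]; push_cast; rfl
    have hj' : j = 2 ^ (t - s) * 2 ^ s * q := by
      rw [← ZMod.natCast_zmod_val j, hjq, ← pow_add, Nat.sub_add_cancel hle]; push_cast; rfl
    rw [Nat.cast_add, hz, hi', hj']
    push_cast
    rw [ZMod.natCast_zmod_val]
    linear_combination (-(2 ^ (t - s) * 2 ^ s * q : ZMod (2 * 2 ^ k))) * hunit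
  by_cases hi : i = 0
  · subst hi
    exact powerGraph_adj_one _ fun h => hij (a.inj h).symm
  by_cases hj : j = 0
  · subst hj
    exact (powerGraph_adj_one _ fun h => hij (a.inj h)).symm
  refine ⟨fun h => hij (a.inj h), ?_⟩
  simp only [a_pow, a.injEq]
  rcases le_total (i.val.factorization 2) (j.val.factorization 2) with h | h
  · exact Or.inl (key i j hi hj h)
  · exact Or.inr (key j i hj hi h)

theorem powerGraph_adj_a_natCast {k : ℕ} [NeZero (2 ^ k)] (v : QuaternionGroup (2 ^ k))
    (hv : v ≠ a ((2 ^ k : ℕ) : ZMod (2 * 2 ^ k))) :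
    (powerGraph (QuaternionGroup (2 ^ k))).Adj (a ((2 ^ k : ℕ) : ZMod (2 * 2 ^ k))) v := by
  cases v with
  | a j => exact powerGraph_adj_a_a fun h => hv (by rw [h])
  | xa j => exact ((powerGraph_adj_xa_iff j _).2 (Or.inr (Or.inl rfl))).symm

/-! ### Laplacian integrality when `n` is a power of 2. -/

open Classical in
theorem sum_adj_xa [NeZero n] (y : QuaternionGroup n → ℝ) (i : ZMod (2 * n)) :
    ∑ w, (if (powerGraph (QuaternionGroup n)).Adj (xa i) w then y (xa i) - y w else 0) =
      (y (xa i) - y 1) + (y (xa i) - y (a n)) + (y (xa i) - y (xa (i + (n : ZMod (2 * n))))) := by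
  have h1 : ∀ j, (xa j : QuaternionGroup n) ≠ 1 := fun j => by rw [one_def]; simp [-a_zero]
  have : ∀ w, (if (powerGraph (QuaternionGroup n)).Adj (xa i) w then y (xa i) - y w else 0) =
      (if w = 1 then y (xa i) - y 1 else 0) + (if w = a n then y (xa i) - y (a n) else 0) +
      (if w = xa (i + (n : ZMod (2 * n))) then y (xa i) - y (xa (i + (n : ZMod (2 * n)))) else 0) := by
    intro w
    rw [powerGraph_adj_xa_iff]
    by_cases hw : w = 1
    · subst hw; simp [a_natCast_ne_one, (h1 _).symm]
    by_cases hw' : w = a n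
    · subst hw'; simp [a_natCast_ne_one.symm]
    by_cases hw'' : w = xa (i + (n : ZMod (2 * n)))
    · subst hw''; simp [h1]
    simp [hw, hw', hw'']
  simp [this, Finset.sum_add_distrib]

/-- An eigenvector with non-integer eigenvalue is shown to vanish: each quantity that the eigenvalue
equation multiplies by an integer must be zero. -/
theorem isLaplacianIntegral_powerGraph {k : ℕ} [NeZero (2 ^ k)] :
    IsLaplacianIntegral (powerGraph (QuaternionGroup (2 ^ k))) := by
  classical
  intro r
  obtain ⟨b, hb, -⟩ := exists_laplacian_eigenbasis (powerGraph (QuaternionGroup (2 ^ k)))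
  have hev := hb r
  generalize laplacianEigenvalues (powerGraph (QuaternionGroup (2 ^ k))) r = μ at hev
  set y : QuaternionGroup (2 ^ k) → ℝ := (b r).ofLp with hy
  have hy0 : y ≠ 0 := by
    intro h
    apply b.orthonormal.ne_zero r
    ext v
    exact congrFun h v
  by_contra! hint
  have hμ : ∀ m : ℤ, ∀ t : ℝ, (m : ℝ) * t = μ * t → t = 0 := by
    intro m t h
    by_contra ht
    exact hint m (mul_right_cancel₀ ht h).symm
  have hsum : ∑ v, y v = 0 :=
    hμ 0 _ (by rw [mul_sum_eq_zero_of_eigenvector _ hev]; simp)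
  have huniv : ∀ e, (∀ v, v ≠ e → (powerGraph (QuaternionGroup (2 ^ k))).Adj e v) → y e = 0 := by
    intro e he
    have h := hev e
    rw [sum_eq_of_universal _ he, hsum, sub_zero] at h
    exact hμ (Fintype.card (QuaternionGroup (2 ^ k))) _ (by exact_mod_cast h)
  have h1 := huniv 1 powerGraph_adj_one
  have hz := huniv _ powerGraph_adj_a_natCast
  have hxa : ∀ i, y (xa i) = 0 := by
    intro i
    have e1 := hev (xa i)
    have e2 := hev (xa (i + (2 ^ k : ℕ)))
    rw [sum_adj_xa, h1, hz] at e1 e2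
    rw [add_assoc i, natCast_add_self, add_zero] at e2
    -- Subtracting the rows at `xa i` and `xa (i + n)` gives the factor 4; once the two values
    -- agree, either row gives the factor 2.
    have h4 := hμ 4 (y (xa i) - y (xa (i + (2 ^ k : ℕ)))) (by rw [Int.cast_ofNat]; linarith)
    exact hμ 2 _ (by rw [Int.cast_ofNat]; linarith)
  have hsa : ∑ i, y (a i) = 0 := by
    rw [sum_eq] at hsum
    simpa [hxa] using hsum
  refine hy0 (funext fun v => ?_)
  cases v with
  | xa i => exact hxa i
  | a i =>
    by_cases hi : i = 0
    · rw [hi]; exact h1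
    by_cases hi' : i = (2 ^ k : ℕ)
    · rw [hi']; exact hz
    have h := hev (a i)
    have hnadj : ∀ j, ¬ (powerGraph (QuaternionGroup (2 ^ k))).Adj (a i) (xa j) := by
      intro j hadj
      rcases (powerGraph_adj_xa_iff j _).1 hadj.symm with h | h | h
      · exact hi (a.inj h)
      · exact hi' (a.inj h)
      · cases h
    have hadj : ∀ j, (if (powerGraph (QuaternionGroup (2 ^ k))).Adj (a i) (a j)
        then y (a i) - y (a j) else 0) = y (a i) - y (a j) := by
      intro j
      by_cases hj : i = j
      · simp [hj]
      · rw [if_pos (powerGraph_adj_a_a hj)]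
    rw [sum_eq] at h
    simp only [hnadj, hadj, if_false, Finset.sum_const_zero, Finset.sum_sub_distrib, hsa,
      Finset.sum_const, Finset.card_univ, ZMod.card, nsmul_eq_mul, add_zero, sub_zero] at h
    exact hμ (2 * 2 ^ k : ℕ) _ (by exact_mod_cast h)

end QuaternionGroup

open QuaternionGroup in
theorem mainTheorem3 (n : ℕ) [NeZero n] (hn : 2 ≤ n) :
    List.TFAE [
      (vertexConnectivity (powerGraph (QuaternionGroup n)) : ℝ) =
        algebraicConnectivity (powerGraph (QuaternionGroup n)),
      algebraicConnectivity (powerGraph (QuaternionGroup n)) = 2,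
      ∃ m : ℤ, algebraicConnectivity (powerGraph (QuaternionGroup n)) = m,
      IsLaplacianIntegral (powerGraph (QuaternionGroup n)),
      IsGeneralizedQuaternion n] := by
  rw [vertexConnectivity_powerGraph hn]
  tfae_have 1 ↔ 2 := by
    rw [eq_comm, Nat.cast_ofNat]
  tfae_have 2 → 3 := fun h => ⟨2, by simpa using h⟩
  tfae_have 4 → 3 := fun h => h _
  tfae_have 3 → 5 := by
    rintro ⟨m, hm⟩
    by_contra h
    obtain ⟨j, h0, h1, hj⟩ := exists_not_adj_of_not_two_pow h
    have hlt := algebraicConnectivity_powerGraph_lt_two hn h0 h1 hj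
    have hgt := one_lt_algebraicConnectivity_powerGraph hn
    rw [hm] at hlt hgt
    have : m < 2 := by exact_mod_cast hlt
    have : 1 < m := by exact_mod_cast hgt
    omega
  tfae_have 5 → 4 := by
    rintro ⟨k, rfl⟩
    exact isLaplacianIntegral_powerGraph
  tfae_have 5 → 2 := by
    intro h
    refine le_antisymm (algebraicConnectivity_powerGraph_le_two hn) ?_
    obtain ⟨k, rfl⟩ := h
    exact two_le_algebraicConnectivity _ a_natCast_ne_one powerGraph_adj_one
      powerGraph_adj_a_natCast
  tfae_finish
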